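/- **Definitions.** Let $X$ be a set. For $A\subseteq X$ and a family $\mathcal U$ of subsets of $X$, the star $st(A,\mathcal U)$ is the union of all $U\in\mathcal U$ with $U\cap A\neq\emptyset$. A large scale structure on $X$ is a nonempty family of covers of $X$ (called uniformly bounded covers) such that (i) if $\mathcal U,\mathcal V$ belong to it, so does $\{st(U,\mathcal V) : U\in\mathcal U\}$; (ii) if $\mathcal U$ belongs to it, so does every cover of $X$ each of whose elements is contained in some element of $\mathcal U$; (iii) the union of two bounded sets is bounded, where a set is called bounded if it is contained in an element of some uniformly bounded cover. A set $A\subseteq X$ is coarsely clopen if $st(A,\mathcal U)\cap st(X\setminus A,\mathcal U)$ is bounded for every uniformly bounded cover $\mathcal U$. An end of $X$ is a family of unbounded coarsely clopen subsets of $X$ that is maximal with respect to the property that all intersections of finitely many of its members are unbounded (the empty intersection being $X$). A bornology on a set is a cover of the set by subsets (called bounded) that is stable under passing to subsets and under finite unions. A coarse group (large scale group) is a group $G$ with a bornology that is stable under inverses $B\mapsto B^{-1}$ and products $(B,C)\mapsto B\cdot C$. It carries the large scale structure whose uniformly bounded covers are the covers of $G$ that refine $\{g\cdot B\}_{g\in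 G}$ for some bounded set $B$; the ends of $G$ are the ends of this structure. **Theorem 9.16.** Let $G$ be a coarse group whose bornology consists of all finite subsets of $G$. If $G$ has exactly $2$ ends, then $G$ is finitely generated, and $G$ contains an infinite cyclic subgroup of finite index. -/

import Mathlib

open scoped Pointwise

/-- The star `st(A, 𝒰)` of a set `A`: the union, over `x ∈ A`, of all `U ∈ 𝒰` containing `x`. -/
def starOf {X : Type*} (A : Set X) (𝒰 : Set (Set X)) : Set X :=
  {y | ∃ x ∈ A, ∃ U ∈ 𝒰, x ∈ U ∧ y ∈ U}

/-- A large scale structure on `X`: a nonempty family of covers of `X` (the uniformly bounded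
covers), closed under stars and under refinements. A set is bounded when it is contained in a
member of a uniformly bounded cover, and the union of two bounded sets is required to be
bounded (coarse connectivity). -/
structure LargeScaleStructure (X : Type*) where
  /-- The family of uniformly bounded covers. -/
  covers : Set (Set (Set X))
  nonempty : covers.Nonempty
  isCover : ∀ 𝒰 ∈ covers, ⋃₀ 𝒰 = Set.univ
  star_mem : ∀ 𝒰 ∈ covers, ∀ 𝒱 ∈ covers, (fun A => starOf A 𝒱) '' 𝒰 ∈ covers
  refine_mem : ∀ 𝒰 ∈ covers, ∀ 𝒱 : Set (Set X), ⋃₀ 𝒱 = Set.univ →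
    (∀ V ∈ 𝒱, ∃ U ∈ 𝒰, V ⊆ U) → 𝒱 ∈ covers
  bounded_union : ∀ A B : Set X, (∃ 𝒰 ∈ covers, ∃ U ∈ 𝒰, A ⊆ U) →
    (∃ 𝒰 ∈ covers, ∃ U ∈ 𝒰, B ⊆ U) → ∃ 𝒰 ∈ covers, ∃ U ∈ 𝒰, A ∪ B ⊆ U

namespace LargeScaleStructure

variable {X : Type*} (L : LargeScaleStructure X)

/-- A set is bounded if it is contained in a member of a uniformly bounded cover. -/
def Bounded (A : Set X) : Prop := ∃ 𝒰 ∈ L.covers, ∃ U ∈ 𝒰, A ⊆ U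

/-- `A` and `C` are coarsely disjoint if `st(A, 𝒰) ∩ st(C, 𝒰)` is bounded for every uniformly
bounded cover `𝒰`. -/
def CoarselyDisjoint (A C : Set X) : Prop :=
  ∀ 𝒰 ∈ L.covers, L.Bounded (starOf A 𝒰 ∩ starOf C 𝒰)

/-- `A` is coarsely clopen if `A` and its complement are coarsely disjoint. -/
def CoarselyClopen (A : Set X) : Prop := L.CoarselyDisjoint A Aᶜ

/-- An end: a family of unbounded coarsely clopen sets that is maximal with respect to the
property that all finite intersections of members are unbounded. The empty intersection is the
whole space, so a bounded space has no ends. -/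
def IsEnd (E : Set (Set X)) : Prop :=
  Maximal (fun F : Set (Set X) =>
    (∀ A ∈ F, ¬ L.Bounded A ∧ L.CoarselyClopen A) ∧
      ∀ T : Set (Set X), T.Finite → T ⊆ F → ¬ L.Bounded (⋂₀ T)) E

/-- The set of all ends. -/
def ends : Set (Set (Set X)) := {E | L.IsEnd E}

end LargeScaleStructure

/-- A large scale group (coarse group) is a group with a bornology that is stable under
inverses and products; these are exactly the bornologies which induce a large scale structure
through the covers by left translates of bounded sets. -/
class IsLargeScaleGroup (G : Type*) [Group G] [Bornology G] : Prop where
  inv_bounded : ∀ B : Set G, Bornology.IsBounded B → Bornology.IsBounded B⁻¹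
  mul_bounded : ∀ B C : Set G, Bornology.IsBounded B → Bornology.IsBounded C →
    Bornology.IsBounded (B * C)

/-- The large scale structure of a large scale group: its uniformly bounded covers are the
covers of `G` that refine `{g • B | g ∈ G}` for some bounded set `B`. -/
def groupLargeScale (G : Type*) [Group G] [Bornology G] [IsLargeScaleGroup G] :
    LargeScaleStructure G where
  covers := {𝒰 | ⋃₀ 𝒰 = Set.univ ∧
    ∃ B : Set G, Bornology.IsBounded B ∧ ∀ U ∈ 𝒰, ∃ g : G, U ⊆ g • B}
  nonempty := by
    refine ⟨Set.range fun g : G => g • ({1} : Set G), ?_, {1},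
      Bornology.isBounded_singleton, ?_⟩
    · refine Set.eq_univ_of_forall fun g => ⟨g • ({1} : Set G), ⟨g, rfl⟩, ?_⟩
      simp
    · rintro _ ⟨g, rfl⟩
      exact ⟨g, subset_rfl⟩
  isCover := fun _ h => h.1
  star_mem := by
    rintro 𝒰 ⟨hU, B, hB, hUB⟩ 𝒱 ⟨hV, C, hC, hVC⟩
    refine ⟨Set.eq_univ_of_forall fun x => ?_, B * (C⁻¹ * C),
      IsLargeScaleGroup.mul_bounded _ _ hB
        (IsLargeScaleGroup.mul_bounded _ _ (IsLargeScaleGroup.inv_bounded _ hC) hC), ?_⟩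
    · obtain ⟨U, hU', hx⟩ := hU.symm ▸ Set.mem_univ x
      obtain ⟨V, hV', hx'⟩ := hV.symm ▸ Set.mem_univ x
      exact ⟨_, ⟨U, hU', rfl⟩, x, hx, V, hV', hx', hx'⟩
    · rintro _ ⟨U, hU', rfl⟩
      obtain ⟨g, hg⟩ := hUB U hU'
      refine ⟨g, ?_⟩
      rintro y ⟨x, hx, V, hV', hxV, hyV⟩
      obtain ⟨h, hh⟩ := hVC V hV'
      obtain ⟨b, hb, rfl⟩ := hg hx
      obtain ⟨c, hc, hcb⟩ := hh hxV
      obtain ⟨d, hd, rfl⟩ := hh hyV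
      refine ⟨b * (c⁻¹ * d), Set.mul_mem_mul hb
        (Set.mul_mem_mul (Set.inv_mem_inv.mpr hc) hd), ?_⟩
      simp only [smul_eq_mul] at hcb ⊢
      rw [← mul_assoc, ← hcb]
      group
  refine_mem := by
    rintro 𝒰 ⟨_, B, hB, hUB⟩ 𝒱 hV h
    refine ⟨hV, B, hB, fun V hV' => ?_⟩
    obtain ⟨U, hU', hVU⟩ := h V hV'
    obtain ⟨g, hg⟩ := hUB U hU'
    exact ⟨g, hVU.trans hg⟩
  bounded_union := by
    rintro A A' ⟨𝒰, ⟨_, B, hB, hUB⟩, U, hU', hAU⟩ ⟨𝒱, ⟨_, C, hC, hVC⟩, V, hV', hAV⟩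
    obtain ⟨g, hg⟩ := hUB U hU'
    obtain ⟨h, hh⟩ := hVC V hV'
    have key : ∀ (k : G) (D : Set G), Bornology.IsBounded D →
        Bornology.IsBounded (k • D) := fun k D hD => by
      rw [← Set.singleton_smul, smul_eq_mul]
      exact IsLargeScaleGroup.mul_bounded _ _ Bornology.isBounded_singleton hD
    refine ⟨{A ∪ A'} ∪ Set.range fun x : G => {x}, ⟨?_, (g • B ∪ h • C) ∪ {1},
      ((key g B hB).union (key h C hC)).union Bornology.isBounded_singleton, ?_⟩,
      A ∪ A', Or.inl rfl, subset_rfl⟩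
    · exact Set.eq_univ_of_forall fun x => ⟨{x}, Or.inr ⟨x, rfl⟩, rfl⟩
    · rintro W (rfl | ⟨x, rfl⟩)
      · refine ⟨1, ?_⟩
        rw [one_smul]
        exact (Set.union_subset_union (hAU.trans hg) (hAV.trans hh)).trans
          Set.subset_union_left
      · refine ⟨x, ?_⟩
        rintro _ rfl
        exact ⟨1, Or.inr rfl, by simp⟩

/-! For the finite bornology, bounded means finite and coarsely clopen means right almost invariant
(`groupLargeScale_coarselyClopen_iff`). Two ends thus yield an almost invariant `A`, infinite with
infinite complement, such that no almost invariant set cuts `A` or `Aᶜ` into two infinite pieces.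
Every left translate of `A` then agrees, up to a finite set, with `A` or `Aᶜ`, so the left
translations almost preserving `A` form a subgroup `H` of index at most two, in which the trace of
`A` is almost invariant on both sides.

With such a set, every infinite finitely generated subgroup of `H` has finite index
(`finiteIndex_of_fg_of_infinite`). One exists: otherwise `G` would be countable and locally finite,
and `exists_split_of_locallyFinite` would cut `A`. So `H` is finitely generated, and translating
boundaries in its Cayley graph produces an element of infinite order (`exists_not_isOfFinOrder`).
Its powers have finite index in `H`, hence in `G`, and finite generation of `G` follows. -/

open Filter

/-! ### Almost invariant sets and their boundaries -/

/-- A subset of a group which changes only by a finite set under each right translation. -/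
def RightAlmostInvariant {G : Type*} [Group G] (A : Set G) : Prop :=
  ∀ g : G, ∀ᶠ x in cofinite, (x * g ∈ A ↔ x ∈ A)

/-- A subset of a group which changes only by a finite set under each left translation. -/
def LeftAlmostInvariant {G : Type*} [Group G] (A : Set G) : Prop :=
  ∀ g : G, ∀ᶠ x in cofinite, (g * x ∈ A ↔ x ∈ A)

theorem RightAlmostInvariant.compl {G : Type*} [Group G] {A : Set G}
    (hA : RightAlmostInvariant A) : RightAlmostInvariant Aᶜ := fun g => by
  filter_upwards [hA g] with x hx
  simp [hx]

theorem LeftAlmostInvariant.compl {G : Type*} [Group G] {A : Set G}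
    (hA : LeftAlmostInvariant A) : LeftAlmostInvariant Aᶜ := fun g => by
  filter_upwards [hA g] with x hx
  simp [hx]

theorem RightAlmostInvariant.inter {G : Type*} [Group G] {A B : Set G}
    (hA : RightAlmostInvariant A) (hB : RightAlmostInvariant B) :
    RightAlmostInvariant (A ∩ B) := fun g => by
  filter_upwards [hA g, hB g] with x hx hx'
  simp [hx, hx']

theorem tendsto_mul_left_cofinite {G : Type*} [Group G] (g : G) :
    Tendsto (fun x => g * x) cofinite cofinite :=
  (mul_right_injective g).tendsto_cofinite

theorem RightAlmostInvariant.preimage_mul_left {G : Type*} [Group G] {A : Set G}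
    (hA : RightAlmostInvariant A) (a : G) :
    RightAlmostInvariant ((fun x => a * x) ⁻¹' A) := fun g => by
  filter_upwards [(tendsto_mul_left_cofinite a).eventually (hA g)] with x hx
  simpa [mul_assoc] using hx

/-- If right multiplication by each element of `S` preserves membership in `A` along the coset
of `x`, so does right multiplication by the subgroup generated by `S`. -/
theorem mem_iff_of_mem_closure {G : Type*} [Group G] {S A : Set G} {x : G}
    (h : ∀ y ∈ Subgroup.closure S, ∀ s ∈ S, (x * y * s ∈ A ↔ x * y ∈ A)) {f : G}
    (hf : f ∈ Subgroup.closure S) : x * f ∈ A ↔ x ∈ A := by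
  induction hf using Subgroup.closure_induction_right with
  | one => simp
  | mul_right y hy s hs ih => rw [← mul_assoc, h y hy s hs, ih]
  | mul_inv_cancel y hy s hs ih =>
    have := h (y * s⁻¹) (mul_mem hy (inv_mem (Subgroup.subset_closure hs))) s hs
    rw [← ih, ← mul_assoc]
    simpa [mul_assoc] using this.symm

/-- The finite set of points at which membership in `A` changes under a generator. -/
theorem RightAlmostInvariant.finite_boundary {G : Type*} [Group G] {A : Set G}
    (hA : RightAlmostInvariant A) {S : Set G} (hS : S.Finite) :
    {x | ¬ ∀ s ∈ S, (x * s ∈ A ↔ x ∈ A)}.Finite :=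
  eventually_cofinite.mp ((eventually_all_finite hS).mpr fun s _ => hA s)

/-- If `A` is left almost invariant and has finite boundary with respect to generators of an
infinite subgroup, it contains no coset of that subgroup unless it is cofinite. -/
theorem false_of_coset_subset {G : Type*} [Group G] {A : Set G}
    (hL : LeftAlmostInvariant A) {S : Set G}
    {F : Subgroup G} (hF : Infinite F) (hFS : Subgroup.closure S = F)
    (hD : {x | ¬ ∀ s ∈ S, (x * s ∈ A ↔ x ∈ A)}.Finite) (hAc : Aᶜ.Infinite)
    {x₀ : G} (hx₀ : ∀ f ∈ F, x₀ * f ∈ A) : False := by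
  have hF' : (F : Set G).Infinite := Set.infinite_coe_iff.mp hF
  -- Left translation by `g * x₀⁻¹` carries `x₀F` onto `gF`, so every coset `gF` is almost contained
  -- in `A`.
  have fin : ∀ g : G, {f : G | f ∈ F ∧ g * f ∉ A}.Finite := fun g => by
    have h := (tendsto_mul_left_cofinite x₀).eventually (hL (g * x₀⁻¹))
    refine (eventually_cofinite.mp h).subset ?_
    rintro f ⟨hf, hgf⟩ hh
    apply hgf
    have := hh.mpr (hx₀ f hf)
    simpa [mul_assoc] using this
  -- `Aᶜ` is covered by the finite sets `dF \ A` with `d` in the boundary: a coset that meets `Aᶜ`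
  -- but avoids the boundary would lie wholly in `Aᶜ`, against `fin`.
  refine hAc ((hD.biUnion fun d _ => (fin d).image fun f => d * f).subset ?_)
  intro x hx
  by_cases hxD : ∃ f ∈ F, x * f ∈ {x | ¬ ∀ s ∈ S, (x * s ∈ A ↔ x ∈ A)}
  · obtain ⟨f, hf, hd⟩ := hxD
    refine Set.mem_biUnion hd ⟨f⁻¹, ⟨inv_mem hf, ?_⟩, ?_⟩
    · simpa using hx
    · simp
  · exfalso
    refine hF' ((fin x).subset fun f hf => ⟨hf, ?_⟩)
    rw [mem_iff_of_mem_closure (S := S) (A := A) _ (hFS ▸ hf)]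
    · exact hx
    · intro y hy s hs
      by_contra hcon
      exact hxD ⟨y, hFS ▸ hy, fun h => hcon (h s hs)⟩

/-- A bilaterally almost invariant set which is neither finite nor cofinite forces infinite
finitely generated subgroups to have finite index. -/
theorem finiteIndex_of_fg_of_infinite {G : Type*} [Group G] {A : Set G}
    (hR : RightAlmostInvariant A) (hL : LeftAlmostInvariant A) (hA : A.Infinite)
    (hAc : Aᶜ.Infinite) {F : Subgroup G} (hfg : F.FG) (hF : Infinite F) : F.FiniteIndex := by
  obtain ⟨S, hFS, hS⟩ := (Subgroup.fg_iff F).mp hfg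
  have hD := hR.finite_boundary hS
  have hDc := hR.compl.finite_boundary hS
  -- Either every coset meets the finite boundary, so there are finitely many, or some coset lies
  -- entirely in `A` or in `Aᶜ`.
  by_cases hx : ∀ x : G, ∃ f ∈ F, x * f ∈ {x | ¬ ∀ s ∈ S, (x * s ∈ A ↔ x ∈ A)}
  · have : Finite (G ⧸ F) := by
      rw [← Set.finite_univ_iff]
      refine (hD.image (QuotientGroup.mk : G → G ⧸ F)).subset fun q _ => ?_
      induction q using QuotientGroup.induction_on with
      | H x =>
        obtain ⟨f, hf, hd⟩ := hx x
        exact ⟨x * f, hd, (QuotientGroup.mk_mul_of_mem x hf)⟩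
    exact Subgroup.finiteIndex_of_finite_quotient
  · exfalso
    obtain ⟨x, hx⟩ := not_forall.mp hx
    have key : ∀ f ∈ F, (x * f ∈ A ↔ x ∈ A) := fun f hf => by
      refine mem_iff_of_mem_closure (S := S) (fun y hy s hs => ?_) (hFS ▸ hf)
      by_contra hcon
      exact hx ⟨y, hFS ▸ hy, fun h => hcon (h s hs)⟩
    by_cases hxA : x ∈ A
    · exact false_of_coset_subset hL hF hFS hD hAc fun f hf => (key f hf).mpr hxA
    · exact false_of_coset_subset hL.compl hF hFS hDc (by rwa [compl_compl])
        fun f hf h => hxA ((key f hf).mp h)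

theorem Set.Countable.subgroup_closure {G : Type*} [Group G] {S : Set G} (hS : S.Countable) :
    (Subgroup.closure S : Set G).Countable := by
  have := hS.to_subtype
  rw [← Subtype.range_coe (s := S), ← FreeGroup.range_lift_eq_closure, MonoidHom.coe_range]
  have : Countable (FreeGroup S) := Quot.mk_surjective.countable
  exact Set.countable_range _

/-- A bilaterally almost invariant set which is neither finite nor cofinite forces
countability. -/
theorem countable_of_almostInvariant {G : Type*} [Group G] {A : Set G}
    (hR : RightAlmostInvariant A) (hL : LeftAlmostInvariant A) (hA : A.Infinite)
    (hAc : Aᶜ.Infinite) : Countable G := by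
  let u := hA.natEmbedding
  let v := hAc.natEmbedding
  let S : Set G := (Set.range fun n => (u n : G)) ∪ Set.range fun n => (v n : G)
  let C := Subgroup.closure S
  have hC : (C : Set G).Countable :=
    ((Set.countable_range _).union (Set.countable_range _)).subgroup_closure
  have huC : ∀ n, (u n : G) ∈ C := fun n => Subgroup.subset_closure (Or.inl ⟨n, rfl⟩)
  have hvC : ∀ n, (v n : G) ∈ C := fun n => Subgroup.subset_closure (Or.inr ⟨n, rfl⟩)
  have hu : Tendsto (fun n => (u n : G)) cofinite cofinite :=
    (Subtype.val_injective.comp u.injective).tendsto_cofinite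
  have hv : Tendsto (fun n => (v n : G)) cofinite cofinite :=
    (Subtype.val_injective.comp v.injective).tendsto_cofinite
  rw [← Set.countable_univ_iff]
  -- For suitable `m`, `n`, the point `g * u m` is in `A` while `g * v n` is not. They differ by `d
  -- = (u m)⁻¹ * v n ∈ C`, so `g * u m` lies in the finite set where `A` changes under `d`.
  refine (hC.biUnion fun c _ => hC.biUnion fun d _ =>
    ((eventually_cofinite.mp (hR d)).image fun x => x * c⁻¹).countable).mono fun g _ => ?_
  obtain ⟨m, hm⟩ := (hu.eventually (hL g)).exists
  obtain ⟨n, hn⟩ := (hv.eventually (hL g)).exists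
  refine Set.mem_biUnion (huC m) (Set.mem_biUnion (mul_mem (inv_mem (huC m)) (hvC n))
    ⟨g * u m, fun h => ?_, by simp⟩)
  rw [hm] at h
  have h1 := h.mpr (u m).2
  simp only [mul_assoc, mul_inv_cancel_left] at h1
  exact (v n).2 (hn.mp h1)

/-- A finitely generated group with a bilaterally almost invariant set which is neither finite
nor cofinite contains an element of infinite order. -/
theorem exists_not_isOfFinOrder {G : Type*} [Group G] [hfg : Group.FG G] {A : Set G}
    (hR : RightAlmostInvariant A) (hL : LeftAlmostInvariant A) (hA : A.Infinite)
    (hAc : Aᶜ.Infinite) : ∃ g : G, ¬ IsOfFinOrder g := by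
  obtain ⟨S, hS, hSfin⟩ := Group.fg_iff.mp hfg
  set D := {x | ¬ ∀ s ∈ S ∪ S⁻¹, (x * s ∈ A ↔ x ∈ A)}
  have hD : D.Finite := hR.finite_boundary (hSfin.union hSfin.inv)
  have ho : ∀ x ∉ D, ∀ s ∈ S ∪ S⁻¹, (x * s ∈ A ↔ x ∈ A) := fun x hx => not_not.mp hx
  -- Connectedness of the Cayley graph: a nonempty set without boundary is everything.
  have all_mem : ∀ P : Set G, (∀ x ∈ P, ∀ s ∈ S ∪ S⁻¹, x * s ∈ P) →
      P.Nonempty → ∀ x, x ∈ P := by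
    rintro P hP ⟨p, hp⟩ x
    have := (mem_iff_of_mem_closure (S := S) (A := P) (x := p) (f := p⁻¹ * x)
      (fun y _ s hs => ⟨fun h => ?_, fun h => hP _ h s (Or.inl hs)⟩)
      (by rw [hS]; trivial)).mpr hp
    · simpa using this
    · simpa using hP _ h s⁻¹ (Or.inr (Set.inv_mem_inv.mpr hs))
  have ev : ∀ᶠ g in cofinite, ∀ d ∈ D, (g * d ∈ A ↔ g ∈ A) :=
    (eventually_all_finite hD).mpr fun d _ => hR d
  have ev' : ∀ᶠ g : G in cofinite, ∀ d ∈ D, (g⁻¹ * d ∈ A ↔ g⁻¹ ∈ A) :=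
    inv_injective.tendsto_cofinite.eventually ev
  -- Thus `gD ⊆ A`, and `g⁻¹D` lies on the same side of `A` as `g⁻¹`.
  obtain ⟨g, hgA, h1, h2⟩ := ((frequently_cofinite_iff_infinite.mpr hA).and_eventually
    (ev.and ev')).exists
  have hgD : ∀ x ∉ A, g⁻¹ * x ∉ D := fun x hx hd => by
    have := (h1 _ hd).mpr hgA
    simp only [mul_inv_cancel_left] at this
    exact hx this
  by_cases hg : g⁻¹ ∈ A
  -- This case is impossible: `gAᶜ ∩ Aᶜ` has no boundary, hence is empty, yet left almost invariance
  -- gives it a point.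
  · have hP : ∀ x, ¬ (g⁻¹ * x ∉ A ∧ x ∉ A) := fun y hy => by
      obtain ⟨x, hx⟩ := hA.nonempty
      refine (all_mem {x | g⁻¹ * x ∉ A ∧ x ∉ A} ?_ ⟨y, hy⟩ x).2 hx
      rintro x ⟨hx, hx'⟩ s hs
      have hxD : x ∉ D := fun hd => hx ((h2 x hd).mpr hg)
      refine ⟨?_, fun h => hx' ((ho x hxD s hs).mp h)⟩
      rw [← mul_assoc]
      exact fun h => hx ((ho _ (hgD x hx') s hs).mp h)
    obtain ⟨x, hx, hx'⟩ := ((frequently_cofinite_iff_infinite.mpr hAc).and_eventually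
      (hL g⁻¹)).exists
    exact absurd ⟨fun h => hx (hx'.mp h), hx⟩ (hP x)
  · have hDA : ∃ d ∈ D, d ∈ A := by
      by_contra! hne
      obtain ⟨x, hx⟩ := hAc.nonempty
      exact hx (all_mem A (fun y hy s hs => (ho y (fun hd => hne y hd hy) s hs).mpr hy)
        hA.nonempty x)
    -- `gA \ A` has no boundary and misses `A`, so it is empty: `gA ⊆ A`.
    have hP : ∀ x, g⁻¹ * x ∈ A → x ∈ A := fun y hy => by
      by_contra hy'
      obtain ⟨x, hx⟩ := hA.nonempty
      refine (all_mem {x | g⁻¹ * x ∈ A ∧ x ∉ A} ?_ ⟨y, hy, hy'⟩ x).2 hx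
      rintro x ⟨hx, hx'⟩ s hs
      have hxD : x ∉ D := fun hd => hg ((h2 x hd).mp hx)
      refine ⟨?_, fun h => hx' ((ho x hxD s hs).mp h)⟩
      rw [← mul_assoc]
      exact (ho _ (hgD x hx') s hs).mpr hx
    -- If `g` had finite order, `g⁻¹` would be a natural power of `g` and would map `A` into itself,
    -- but it sends `d ∈ D ∩ A` outside `A`.
    refine ⟨g, fun hfo => ?_⟩
    obtain ⟨n, hn⟩ := hfo.mem_powers_iff_mem_zpowers.mpr (inv_mem (Subgroup.mem_zpowers g))
    have hpow : ∀ n : ℕ, ∀ x ∈ A, g ^ n * x ∈ A := fun n => by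
      induction n with
      | zero => simp
      | succ k ih =>
        intro x hx
        rw [pow_succ, mul_assoc]
        exact ih _ (hP _ (by simpa using hx))
    obtain ⟨d, hd, hdA⟩ := hDA
    have := hpow n d hdA
    simp only at hn
    rw [hn] at this
    exact hg ((h2 d hd).mp this)

/-! ### Locally finite groups -/

/-- A countable group all of whose finitely generated subgroups are finite has an
almost invariant set splitting any given infinite set into two infinite pieces. -/
theorem exists_split_of_locallyFinite {G : Type*} [Group G] [Countable G]
    (hloc : ∀ F : Subgroup G, F.FG → Finite F) {A : Set G} (hA : A.Infinite) :
    ∃ B : Set G, RightAlmostInvariant B ∧ (A ∩ B).Infinite ∧ (A ∩ Bᶜ).Infinite := by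
  obtain ⟨e, he⟩ := exists_surjective_nat G
  let F : ℕ → Subgroup G := fun n => Subgroup.closure (e '' Set.Iic n)
  have hFmono : Monotone F := fun m n h =>
    Subgroup.closure_mono (Set.image_mono (Set.Iic_subset_Iic.mpr h))
  have hFfin : ∀ n, (F n : Set G).Finite := fun n =>
    Set.finite_coe_iff.mp (hloc _ ((Subgroup.fg_iff _).mpr
      ⟨_, rfl, (Set.finite_Iic n).image e⟩))
  have hex : ∀ x, ∃ n, x ∈ F n := fun x => by
    obtain ⟨n, rfl⟩ := he x
    exact ⟨n, Subgroup.subset_closure ⟨n, Set.mem_Iic.mpr le_rfl, rfl⟩⟩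
  classical
  let r : G → ℕ := fun x => Nat.find (hex x)
  have hr : ∀ x n, r x ≤ n ↔ x ∈ F n := fun x n =>
    ⟨fun h => hFmono h (Nat.find_spec (hex x)), fun h => Nat.find_min' _ h⟩
  -- Multiplying by an element of lower level preserves the level, so any union of level sets of `r`
  -- is almost invariant.
  have hmul : ∀ x g, r g < r x → r (x * g) = r x := fun x g h => by
    have key : ∀ n, r g ≤ n → (r (x * g) ≤ n ↔ r x ≤ n) := fun n hn => by
      rw [hr, hr, Subgroup.mul_mem_cancel_right _ ((hr g n).mp hn)]
    apply le_antisymm ((key _ h.le).mpr le_rfl)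
    by_contra! hlt
    rcases le_total (r g) (r (x * g)) with h' | h'
    · exact absurd ((key _ h').mp le_rfl) (by omega)
    · exact absurd ((key _ le_rfl).mp h') (by omega)
  have hinv : ∀ I : Set ℕ, RightAlmostInvariant (r ⁻¹' I) := fun I g => by
    refine eventually_cofinite.mpr ((hFfin (r g)).subset fun x hx => ?_)
    by_contra hx'
    have : r g < r x := not_le.mp fun h => hx' ((hr x _).mp h)
    apply hx
    simp [hmul x g this]
  have hrA : (r '' A).Infinite := fun hfin => by
    refine hA ((hfin.biUnion fun n _ => hFfin n).subset fun x hx => ?_)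
    exact Set.mem_biUnion (Set.mem_image_of_mem r hx) ((hr x _).mp le_rfl)
  -- Infinitely many levels meet `A`; the even-indexed ones of a sequence form `B`, the odd-indexed
  -- ones stay outside.
  let u := hrA.natEmbedding
  have hu : ∀ n, ∃ x ∈ A, r x = u n := fun n => (u n).2
  choose w hwA hw using hu
  have hwinj : Function.Injective w := fun m n h => by
    apply u.injective
    apply Subtype.ext
    rw [← hw, ← hw, h]
  refine ⟨r ⁻¹' Set.range fun n => (u (2 * n) : ℕ), hinv _, ?_, ?_⟩
  · refine (Set.infinite_range_of_injective (f := fun n => w (2 * n))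
      (hwinj.comp (mul_right_injective₀ two_ne_zero))).mono ?_
    rintro _ ⟨n, rfl⟩
    exact ⟨hwA _, n, (hw _).symm⟩
  · refine (Set.infinite_range_of_injective (f := fun n => w (2 * n + 1)) ?_).mono ?_
    · intro m n h
      have := hwinj h
      omega
    · rintro _ ⟨n, rfl⟩
      refine ⟨hwA _, ?_⟩
      rintro ⟨m, hm⟩
      simp only [hw] at hm
      have := u.injective (Subtype.ext hm)
      omega

/-! ### Passage to and from finite index subgroups -/

theorem Group.fg_of_fg_of_finiteIndex {G : Type*} [Group G] {F : Subgroup G} (hF : F.FG)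
    [F.FiniteIndex] : Group.FG G := by
  obtain ⟨S, hS, hSfin⟩ := (Subgroup.fg_iff F).mp hF
  have hfin : Finite (G ⧸ F) := inferInstance
  refine Group.fg_iff.mpr ⟨S ∪ Set.range (Quotient.out : G ⧸ F → G), ?_,
    hSfin.union (Set.finite_range _)⟩
  refine (Subgroup.eq_top_iff' _).mpr fun x => ?_
  have h1 : ((x : G ⧸ F).out)⁻¹ * x ∈ F := QuotientGroup.eq.mp (Quotient.out_eq _)
  have h2 : ((x : G ⧸ F).out)⁻¹ * x ∈
      Subgroup.closure (S ∪ Set.range (Quotient.out : G ⧸ F → G)) := by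
    refine Subgroup.closure_mono Set.subset_union_left ?_
    rwa [hS]
  have h3 : (x : G ⧸ F).out ∈ Subgroup.closure (S ∪ Set.range (Quotient.out : G ⧸ F → G)) :=
    Subgroup.subset_closure (Or.inr ⟨_, rfl⟩)
  simpa using mul_mem h3 h2

theorem countable_of_finiteIndex {G : Type*} [Group G] (H : Subgroup G) [H.FiniteIndex]
    [Countable H] : Countable G := by
  have : Finite (G ⧸ H) := inferInstance
  exact (Subgroup.groupEquivQuotientProdSubgroup (s := H)).injective.countable

/-- If the finitely generated subgroups of a finite index subgroup are finite, the same holds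
for the whole group. -/
theorem finite_of_fg_of_finiteIndex {G : Type*} [Group G] (H : Subgroup G) [H.FiniteIndex]
    (hloc : ∀ F : Subgroup H, F.FG → Finite F) (F : Subgroup G) (hF : F.FG) : Finite F := by
  have : Group.FG F := (Group.fg_iff_subgroup_fg F).mpr hF
  have h1 : Group.FG (H.subgroupOf F) := inferInstance
  have h2 : Group.FG (F.subgroupOf H) := by
    let f : H.subgroupOf F →* F.subgroupOf H :=
      { toFun := fun x => ⟨⟨x.1.1, x.2⟩, x.1.2⟩
        map_one' := rfl
        map_mul' := fun _ _ => rfl }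
    exact Group.fg_of_surjective (f := f) fun y => ⟨⟨⟨y.1.1, y.2⟩, y.1.2⟩, rfl⟩
  have h3 := hloc _ ((Group.fg_iff_subgroup_fg _).mp h2)
  have h4 : Finite (H.subgroupOf F) :=
    Finite.of_injective (fun x : H.subgroupOf F =>
      (⟨⟨x.1.1, x.2⟩, x.1.2⟩ : F.subgroupOf H)) fun x y h =>
        Subtype.ext (Subtype.ext (congrArg (fun z : F.subgroupOf H => ((z : H) : G)) h))
  have : Finite (F ⧸ H.subgroupOf F) := inferInstance
  exact Finite.of_injective _
    (Subgroup.groupEquivQuotientProdSubgroup (s := H.subgroupOf F)).injective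

/-! ### The left almost stabilizer and the cyclic subgroup -/

/-- The subgroup of left translations which change a set only by a finite set. -/
def leftAlmostStabilizer {G : Type*} [Group G] (A : Set G) : Subgroup G where
  carrier := {g | ∀ᶠ x in cofinite, (g * x ∈ A ↔ x ∈ A)}
  one_mem' := by simp
  mul_mem' := fun {a b} ha hb => by
    change ∀ᶠ x in cofinite, (a * b * x ∈ A ↔ x ∈ A)
    filter_upwards [(tendsto_mul_left_cofinite b).eventually ha, hb] with x h1 h2
    rw [mul_assoc, h1, h2]
  inv_mem' := fun {a} ha => by
    change ∀ᶠ x in cofinite, (a⁻¹ * x ∈ A ↔ x ∈ A)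
    filter_upwards [(tendsto_mul_left_cofinite a⁻¹).eventually ha] with x h1
    rw [← h1, mul_inv_cancel_left]

theorem mem_leftAlmostStabilizer {G : Type*} [Group G] {A : Set G} {g : G} :
    g ∈ leftAlmostStabilizer A ↔ ∀ᶠ x in cofinite, (g * x ∈ A ↔ x ∈ A) := Iff.rfl

/-- If no almost invariant set splits `A` or its complement into two infinite pieces, then the
left almost stabilizer of `A` has finite index (in fact at most two). -/
theorem leftAlmostStabilizer_finiteIndex {G : Type*} [Group G] {A : Set G}
    (hR : RightAlmostInvariant A)
    (hsplit : ∀ B, RightAlmostInvariant B → ¬ ((A ∩ B).Infinite ∧ (A ∩ Bᶜ).Infinite))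
    (hsplit' : ∀ B, RightAlmostInvariant B → ¬ ((Aᶜ ∩ B).Infinite ∧ (Aᶜ ∩ Bᶜ).Infinite))
    (hA : A.Infinite) (hAc : Aᶜ.Infinite) :
    (leftAlmostStabilizer A).FiniteIndex := by
  have hflip : ∀ g ∉ leftAlmostStabilizer A, ∀ᶠ x in cofinite, (g * x ∈ A ↔ x ∉ A) := by
    intro g hg
    have hB := hR.preimage_mul_left g
    set B : Set G := (fun x => g * x) ⁻¹' A with hBdef
    have hBinf : B.Infinite := hA.preimage (by
      rintro x -
      exact ⟨g⁻¹ * x, by simp⟩)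
    have hBcinf : Bᶜ.Infinite := by
      rw [hBdef, ← Set.preimage_compl]
      refine hAc.preimage ?_
      rintro x -
      exact ⟨g⁻¹ * x, by simp⟩
    have h1 := hsplit B hB
    have h2 := hsplit' B hB
    simp only [not_and_or, Set.not_infinite] at h1 h2
    have cof : ∀ {T : Set G}, T.Finite → ∀ᶠ x in cofinite, x ∉ T :=
      fun hT => hT.compl_mem_cofinite
    -- The four cases say that, up to a finite set, `B` is empty, `Aᶜ`, `A` or everything; only the
    -- second is consistent.
    rcases h1 with h1 | h1 <;> rcases h2 with h2 | h2
    · exact absurd ((h1.union h2).subset fun x hx => by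
        by_cases hxA : x ∈ A
        · exact Or.inl ⟨hxA, hx⟩
        · exact Or.inr ⟨hxA, hx⟩) hBinf
    · filter_upwards [cof h1, cof h2] with x hx hx'
      simp only [hBdef, Set.mem_inter_iff, Set.mem_preimage, Set.mem_compl_iff] at hx hx'
      tauto
    · refine absurd ?_ hg
      rw [mem_leftAlmostStabilizer]
      filter_upwards [cof h1, cof h2] with x hx hx'
      simp only [hBdef, Set.mem_inter_iff, Set.mem_preimage, Set.mem_compl_iff] at hx hx'
      tauto
    · exact absurd ((h1.union h2).subset fun x hx => by
        by_cases hxA : x ∈ A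
        · exact Or.inl ⟨hxA, hx⟩
        · exact Or.inr ⟨hxA, hx⟩) hBcinf
  by_cases htop : leftAlmostStabilizer A = ⊤
  · rw [htop]
    infer_instance
  · obtain ⟨a, ha⟩ : ∃ a, a ∉ leftAlmostStabilizer A := by
      by_contra! h
      exact htop ((Subgroup.eq_top_iff' _).mpr h)
    -- Two translations that both almost exchange `A` and `Aᶜ` compose to one that almost preserves
    -- `A`.
    have : (leftAlmostStabilizer A).index = 2 := by
      refine Subgroup.index_eq_two_iff_exists_notMem_and.mpr ⟨a, ha, fun b => ?_⟩
      by_cases hb : b ∈ leftAlmostStabilizer A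
      · exact Or.inr hb
      · left
        rw [mem_leftAlmostStabilizer]
        filter_upwards [(tendsto_mul_left_cofinite a).eventually (hflip b hb),
          hflip a ha] with x h1 h2
        rw [mul_assoc, h1, h2, not_not]
    exact ⟨by omega⟩

theorem infinite_preimage_subtype_of_finiteIndex {G : Type*} [Group G] {A : Set G}
    (hR : RightAlmostInvariant A) (hA : A.Infinite) (H : Subgroup G) [H.FiniteIndex] :
    ((Subtype.val : H → G) ⁻¹' A).Infinite := by
  intro hfin
  have hAH : {x | x ∈ H ∧ x ∈ A}.Finite :=
    (hfin.image Subtype.val).subset fun x hx => ⟨⟨x, hx.1⟩, hx.2, rfl⟩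
  have hq : Finite (G ⧸ H) := inferInstance
  have hshift : ∀ t : G, {x | x ∈ H ∧ x * t ∈ A}.Finite := fun t => by
    refine (hAH.union (eventually_cofinite.mp (hR t))).subset fun x hx => ?_
    by_cases hxA : x ∈ A
    · exact Or.inl ⟨hx.1, hxA⟩
    · exact Or.inr fun h => hxA (h.mp hx.2)
  refine hA ((Set.finite_iUnion fun q : G ⧸ H =>
    (hshift q.out⁻¹).image fun x => x * q.out⁻¹).subset fun x hx => ?_)
  -- The left coset of `x⁻¹` is used because right cosets of `H` are needed: right translation is
  -- what almost preserves `A`.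
  have h1 : (((x⁻¹ : G) : G ⧸ H).out)⁻¹ * x⁻¹ ∈ H := QuotientGroup.eq.mp (Quotient.out_eq _)
  refine Set.mem_iUnion.mpr ⟨((x⁻¹ : G) : G ⧸ H), x * ((x⁻¹ : G) : G ⧸ H).out, ⟨?_, ?_⟩, ?_⟩
  · simpa using inv_mem h1
  · simpa using hx
  · simp

/-- An almost invariant set with infinite complement such that no almost invariant set splits
either of the two into infinite pieces forces an infinite cyclic subgroup of finite index. -/
theorem exists_infinite_cyclic_of_almostInvariant {G : Type*} [Group G] {A : Set G}
    (hR : RightAlmostInvariant A) (hA : A.Infinite) (hAc : Aᶜ.Infinite)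
    (hsplit : ∀ B, RightAlmostInvariant B → ¬ ((A ∩ B).Infinite ∧ (A ∩ Bᶜ).Infinite))
    (hsplit' : ∀ B, RightAlmostInvariant B → ¬ ((Aᶜ ∩ B).Infinite ∧ (Aᶜ ∩ Bᶜ).Infinite)) :
    ∃ H : Subgroup G, IsCyclic H ∧ Infinite H ∧ H.FiniteIndex := by
  have hidx := leftAlmostStabilizer_finiteIndex hR hsplit hsplit' hA hAc
  set H := leftAlmostStabilizer A with hH
  let A' : Set H := Subtype.val ⁻¹' A
  have hval : Tendsto (Subtype.val : H → G) cofinite cofinite :=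
    Subtype.val_injective.tendsto_cofinite
  have hR' : RightAlmostInvariant A' := fun g => hval.eventually (hR g)
  have hL' : LeftAlmostInvariant A' := fun g =>
    hval.eventually (mem_leftAlmostStabilizer.mp g.2)
  have hA' : A'.Infinite := infinite_preimage_subtype_of_finiteIndex hR hA H
  have hAc' : A'ᶜ.Infinite := infinite_preimage_subtype_of_finiteIndex hR.compl hAc H
  have : Countable H := countable_of_almostInvariant hR' hL' hA' hAc'
  have hHfg : Group.FG H := by
    -- `hsplit` concerns subsets of `G`, so countability and local finiteness are carried from `H`
    -- up to `G`.
    by_cases hloc : ∀ F : Subgroup H, F.FG → Finite F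
    · have := countable_of_finiteIndex H
      obtain ⟨B, hB, h1⟩ :=
        exists_split_of_locallyFinite (finite_of_fg_of_finiteIndex H hloc) hA
      exact absurd h1 (hsplit B hB)
    · push Not at hloc
      obtain ⟨F, hF, hFinf⟩ := hloc
      have := finiteIndex_of_fg_of_infinite hR' hL' hA' hAc' hF hFinf
      exact Group.fg_of_fg_of_finiteIndex hF
  obtain ⟨t, ht⟩ := exists_not_isOfFinOrder hR' hL' hA' hAc'
  have hinf : Infinite (Subgroup.zpowers t) :=
    Set.infinite_coe_iff.mpr (infinite_zpowers.mpr ht)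
  have hidx' : (Subgroup.zpowers t).FiniteIndex :=
    finiteIndex_of_fg_of_infinite hR' hL' hA' hAc'
      ((Subgroup.fg_iff _).mpr ⟨{t}, (Subgroup.zpowers_eq_closure t).symm,
        Set.finite_singleton t⟩) hinf
  refine ⟨Subgroup.zpowers (t : G), inferInstance, ?_, ?_⟩
  · exact Set.infinite_coe_iff.mpr (infinite_zpowers.mpr fun h => ht (Submonoid.isOfFinOrder_coe (H := H.toSubmonoid) (x := t).mp h))
  · have hmap : Subgroup.zpowers (t : G) = (Subgroup.zpowers t).map H.subtype := by simp
    rw [hmap]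
    refine ⟨?_⟩
    rw [Subgroup.index_map_subtype]
    exact mul_ne_zero hidx'.index_ne_zero hidx.index_ne_zero

/-! ### Ends of a large scale structure -/

namespace LargeScaleStructure

variable {X : Type*} (L : LargeScaleStructure X)

theorem Bounded.mono {L : LargeScaleStructure X} {A B : Set X} (hB : L.Bounded B)
    (h : A ⊆ B) : L.Bounded A := by
  obtain ⟨𝒰, h𝒰, U, hU, hBU⟩ := hB
  exact ⟨𝒰, h𝒰, U, hU, h.trans hBU⟩

theorem mem_ends_iff {E : Set (Set X)} : E ∈ L.ends ↔
    Maximal (fun F : Set (Set X) => (∀ A ∈ F, ¬ L.Bounded A ∧ L.CoarselyClopen A) ∧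
      ∀ T : Set (Set X), T.Finite → T ⊆ F → ¬ L.Bounded (⋂₀ T)) E := Iff.rfl

/-- Every unbounded coarsely clopen set belongs to an end. -/
theorem exists_end_mem {A : Set X} (hA : ¬ L.Bounded A) (hA' : L.CoarselyClopen A) :
    ∃ E ∈ L.ends, A ∈ E := by
  have key : ∃ E, {A} ⊆ E ∧ Maximal (· ∈ {F : Set (Set X) |
      (∀ A ∈ F, ¬ L.Bounded A ∧ L.CoarselyClopen A) ∧
        ∀ T : Set (Set X), T.Finite → T ⊆ F → ¬ L.Bounded (⋂₀ T)}) E := by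
    refine zorn_subset_nonempty _ (fun c hc hchain hne => ?_) {A} ?_
    · refine ⟨⋃₀ c, ⟨?_, fun T hT hTc => ?_⟩, fun _ => Set.subset_sUnion_of_mem⟩
      · rintro B ⟨F, hF, hBF⟩
        exact (hc hF).1 B hBF
      · obtain ⟨F, hF, hTF⟩ :=
          hchain.directedOn.exists_mem_subset_of_finite_of_subset_sUnion hne hT hTc
        exact (hc hF).2 T hT hTF
    · refine ⟨?_, fun T _ hT hb => hA (hb.mono ?_)⟩
      · rintro _ rfl
        exact ⟨hA, hA'⟩
      · exact Set.subset_sInter fun B hB => (hT hB).ge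
  obtain ⟨E, hAE, hE⟩ := key
  exact ⟨E, hE, hAE rfl⟩

/-- `hbot` can fail only on an empty space, where the empty family is a cover. -/
theorem not_disjoint_of_mem_end {E : Set (Set X)} (hE : E ∈ L.ends) {A B : Set X} (hA : A ∈ E)
    (hB : B ∈ E) (hbot : L.Bounded ∅) : ¬ Disjoint A B := fun h => by
  refine (L.mem_ends_iff.mp hE).prop.2 {A, B} (Set.toFinite _) (Set.pair_subset hA hB) ?_
  rwa [Set.sInter_pair, h.inter_eq]

/-- A space with two ends has no three pairwise disjoint unbounded coarsely clopen sets. -/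
theorem not_three_of_ends (h : L.ends.encard = 2) (hbot : L.Bounded ∅) {A B C : Set X}
    (hA : ¬ L.Bounded A) (hA' : L.CoarselyClopen A)
    (hB : ¬ L.Bounded B) (hB' : L.CoarselyClopen B)
    (hC : ¬ L.Bounded C) (hC' : L.CoarselyClopen C)
    (hAB : Disjoint A B) (hAC : Disjoint A C) (hBC : Disjoint B C) : False := by
  obtain ⟨E, hE, hAE⟩ := L.exists_end_mem hA hA'
  obtain ⟨F, hF, hBF⟩ := L.exists_end_mem hB hB'
  obtain ⟨K, hK, hCK⟩ := L.exists_end_mem hC hC'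
  have hEF : E ≠ F := by
    rintro rfl
    exact L.not_disjoint_of_mem_end hE hAE hBF hbot hAB
  have hEK : E ≠ K := by
    rintro rfl
    exact L.not_disjoint_of_mem_end hE hAE hCK hbot hAC
  have hFK : F ≠ K := by
    rintro rfl
    exact L.not_disjoint_of_mem_end hF hBF hCK hbot hBC
  obtain ⟨P, Q, -, hPQ⟩ := Set.encard_eq_two.mp h
  rw [hPQ] at hE hF hK
  simp only [Set.mem_insert_iff, Set.mem_singleton_iff] at hE hF hK
  grind

/-- A space with two ends has a coarsely clopen set which is unbounded and has unbounded
complement. -/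
theorem exists_clopen_of_ends (h : L.ends.encard = 2) :
    ∃ A, L.CoarselyClopen A ∧ ¬ L.Bounded A ∧ ¬ L.Bounded Aᶜ := by
  obtain ⟨E, F, hEF, hs⟩ := Set.encard_eq_two.mp h
  have hE : E ∈ L.ends := by simp [hs]
  have hF : F ∈ L.ends := by simp [hs]
  rw [mem_ends_iff] at hE hF
  have hnot : ¬ E ⊆ F := fun hle => hEF (hle.antisymm (hE.le_of_ge hF.prop hle))
  obtain ⟨A, hAE, hAF⟩ := Set.not_subset.mp hnot
  obtain ⟨hA, hA'⟩ := hE.prop.1 A hAE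
  -- If `Aᶜ` were bounded, adjoining `A` to `F` would keep finite intersections unbounded, against
  -- maximality of `F`.
  refine ⟨A, hA', hA, fun hAc => hAF ?_⟩
  refine hF.le_of_ge (y := insert A F) ⟨?_, fun T hT hTF hb => ?_⟩ (Set.subset_insert A F)
    (Set.mem_insert A F)
  · rintro B (rfl | hB)
    · exact ⟨hA, hA'⟩
    · exact hF.prop.1 B hB
  · have hT' : T \ {A} ⊆ F := fun B hB => (hTF hB.1).resolve_left hB.2
    refine hF.prop.2 (T \ {A}) hT.sdiff hT' (Bounded.mono
      (L.bounded_union _ _ hb hAc) fun x hx => ?_)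
    by_cases hxA : x ∈ A
    · left
      intro B hB
      by_cases hBA : B = A
      · rwa [hBA]
      · exact hx B ⟨hB, hBA⟩
    · exact Or.inr hxA

end LargeScaleStructure

/-! ### Translation to groups with the finite bornology -/

section

variable {G : Type*} [Group G] [Bornology G] [IsLargeScaleGroup G]

theorem groupLargeScale_bounded_iff (hfin : ∀ S : Set G, Bornology.IsBounded S ↔ S.Finite)
    {A : Set G} : (groupLargeScale G).Bounded A ↔ A.Finite := by
  constructor
  · rintro ⟨𝒰, ⟨-, B, hB, hUB⟩, U, hU, hAU⟩
    obtain ⟨g, hg⟩ := hUB U hU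
    exact (((hfin B).mp hB).smul_set (a := g)).subset (hAU.trans hg)
  · intro hA
    refine ⟨insert A (Set.range fun x : G => {x}), ⟨?_, insert 1 A,
      (hfin _).mpr (hA.insert 1), ?_⟩, A, Or.inl rfl, subset_rfl⟩
    · exact Set.eq_univ_of_forall fun x => ⟨{x}, Or.inr ⟨x, rfl⟩, rfl⟩
    · rintro W (rfl | ⟨x, rfl⟩)
      · exact ⟨1, by rw [one_smul]; exact Set.subset_insert _ _⟩
      · refine ⟨x, ?_⟩
        rintro _ rfl
        exact ⟨1, Or.inl rfl, by simp⟩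

theorem groupLargeScale_coarselyClopen_iff
    (hfin : ∀ S : Set G, Bornology.IsBounded S ↔ S.Finite) {A : Set G} :
    (groupLargeScale G).CoarselyClopen A ↔ RightAlmostInvariant A := by
  constructor
  · intro h g
    -- For the cover by pairs `{x, x * g}`, every `x` at which membership changes lies in both
    -- stars.
    have hc : (Set.range fun x : G => ({x, x * g} : Set G)) ∈ (groupLargeScale G).covers := by
      refine ⟨Set.eq_univ_of_forall fun x => ⟨_, ⟨x, rfl⟩, Or.inl rfl⟩, {1, g},
        (hfin _).mpr (Set.toFinite _), ?_⟩
      rintro _ ⟨x, rfl⟩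
      refine ⟨x, ?_⟩
      rintro _ (rfl | rfl)
      · exact ⟨1, Or.inl rfl, by simp⟩
      · exact ⟨g, Or.inr rfl, by simp⟩
    refine eventually_cofinite.mpr
      (((groupLargeScale_bounded_iff hfin).mp (h _ hc)).subset fun x hx => ?_)
    by_cases hxA : x ∈ A
    · have hxg : x * g ∉ A := fun h' => hx (by simp [hxA, h'])
      exact ⟨⟨x, hxA, _, ⟨x, rfl⟩, Or.inl rfl, Or.inl rfl⟩,
        ⟨x * g, hxg, _, ⟨x, rfl⟩, Or.inr rfl, Or.inl rfl⟩⟩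
    · have hxg : x * g ∈ A := by
        by_contra h'
        exact hx (by simp [hxA, h'])
      exact ⟨⟨x * g, hxg, _, ⟨x, rfl⟩, Or.inr rfl, Or.inl rfl⟩,
        ⟨x, hxA, _, ⟨x, rfl⟩, Or.inl rfl, Or.inl rfl⟩⟩
  · rintro h 𝒰 ⟨-, B, hB, hUB⟩
    rw [groupLargeScale_bounded_iff hfin]
    have hB' := (hfin B).mp hB
    have hQ : (B⁻¹ * B).Finite := hB'.inv.mul hB'
    have hquot : ∀ U ∈ 𝒰, ∀ x ∈ U, ∀ y ∈ U, ∃ q ∈ B⁻¹ * B, y = x * q := by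
      intro U hU x hx y hy
      obtain ⟨g, hg⟩ := hUB U hU
      obtain ⟨b, hb, rfl⟩ := hg hx
      obtain ⟨c, hc, rfl⟩ := hg hy
      exact ⟨b⁻¹ * c, Set.mul_mem_mul (Set.inv_mem_inv.mpr hb) hc, by simp [mul_assoc]⟩
    -- A point `y` of both stars is `x * q` with `x ∈ A` and `x * (q * p) ∉ A`, where `q`, `p` lie
    -- in the finite set `B⁻¹ * B`.
    refine (((hQ.mul hQ).biUnion fun w _ => eventually_cofinite.mp (h w)).mul hQ).subset ?_
    rintro y ⟨⟨x, hx, U, hU, hxU, hyU⟩, ⟨z, hz, V, hV, hzV, hyV⟩⟩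
    obtain ⟨q, hq, rfl⟩ := hquot U hU x hxU y hyU
    obtain ⟨p, hp, rfl⟩ := hquot V hV _ hyV z hzV
    refine Set.mul_mem_mul (Set.mem_biUnion (Set.mul_mem_mul hq hp) fun hh => ?_) hq
    exact hz (by simpa [mul_assoc] using hh.mpr hx)

end

theorem theorem9p16 (G : Type*) [Group G] [Bornology G] [IsLargeScaleGroup G]
    (hfin : ∀ S : Set G, Bornology.IsBounded S ↔ S.Finite)
    (hends : (groupLargeScale G).ends.encard = 2) :
    Group.FG G ∧ ∃ H : Subgroup G, IsCyclic H ∧ Infinite H ∧ H.FiniteIndex := by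
  obtain ⟨A, hR, hA, hAc⟩ := (groupLargeScale G).exists_clopen_of_ends hends
  have hthree : ∀ A B C : Set G, A.Infinite → B.Infinite → C.Infinite →
      RightAlmostInvariant A → RightAlmostInvariant B → RightAlmostInvariant C →
      Disjoint A B → Disjoint A C → Disjoint B C → False := by
    intro A B C
    simp only [Set.Infinite, ← groupLargeScale_bounded_iff hfin,
      ← groupLargeScale_coarselyClopen_iff hfin]
    intro hA hB hC hA' hB' hC'
    exact (groupLargeScale G).not_three_of_ends hends
      ((groupLargeScale_bounded_iff hfin).mpr Set.finite_empty) hA hA' hB hB' hC hC'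
  rw [groupLargeScale_coarselyClopen_iff hfin] at hR
  rw [groupLargeScale_bounded_iff hfin] at hA hAc
  -- A splitting of `A` would make `A ∩ B`, `A ∩ Bᶜ`, `Aᶜ` three disjoint sets, hence three ends.
  have hsplit : ∀ A : Set G, RightAlmostInvariant A → Aᶜ.Infinite → ∀ B,
      RightAlmostInvariant B → ¬ ((A ∩ B).Infinite ∧ (A ∩ Bᶜ).Infinite) := by
    rintro A hR hAc B hB ⟨h1, h2⟩
    exact hthree _ _ _ h1 h2 hAc (hR.inter hB) (hR.inter hB.compl) hR.compl
      (disjoint_compl_right.mono Set.inter_subset_right Set.inter_subset_right)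
      (disjoint_compl_right.mono_left Set.inter_subset_left)
      (disjoint_compl_right.mono_left Set.inter_subset_left)
  obtain ⟨H, hcyc, hinf, hidx⟩ := exists_infinite_cyclic_of_almostInvariant hR hA hAc
    (hsplit A hR hAc) (hsplit Aᶜ hR.compl (by rwa [compl_compl]))
  refine ⟨Group.fg_of_fg_of_finiteIndex (F := H)
    ((Group.fg_iff_subgroup_fg H).mp ?_), H, hcyc, hinf, hidx⟩
  obtain ⟨t, ht⟩ := hcyc.exists_generator
  refine Group.fg_iff.mpr ⟨{t}, (Subgroup.eq_top_iff' _).mpr fun x => ?_, Set.finite_singleton t⟩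
  rw [← Subgroup.zpowers_eq_closure]
  exact ht x
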